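/- Let $Q$ be a unital commutative quantale, i.e. a complete lattice with a commutative monoid structure $(\cdot,1)$ such that $\cdot$ distributes over arbitrary joins, and write $p\to q=\bigvee\{r\in Q\mid r\cdot p\le q\}$. Let $\Omega$ be a type, i.e. a set of function symbols, each with an arity $n\in\mathbb N_0$. A *$Q$-order* on a set $X$ is a map $e\colon X\times X\to Q$ with $1\le e(x,x)$, $e(x,y)\cdot e(y,z)\le e(x,z)$, and such that $1\le e(x,y)$ and $1\le e(y,x)$ imply $x=y$. An element $s\in X$ is the *$Q$-join* $\bigsqcup M$ of $M\in Q^X$ if $M(x)\le e(x,s)$ for all $x\in X$ and $\bigwedge_{x\in X}(M(x)\to e(x,y))\le e(s,y)$ for all $y\in X$. The pair $(X,e)$ is a *$Q$-sup-lattice* if every $M\in Q^X$ has a $Q$-join. For a map $f\colon X\to Y$ and $M\in Q^X$ let $f_Q^{\to}(M)(y)=\bigvee_{f(x)=y}M(x)$; a map $f$ between $Q$-ordered sets is *$Q$-join-preserving* if, whenever $\bigsqcup M$ exists, $\bigsqcup f_Q^{\to}(M)$ exists and $f(\bigsqcup M)=\bigsqcup f_Q^{\to}(M)$. A *$Q$-sup-algebra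 of type $\Omega$* is a $Q$-sup-lattice $A$ equipped with an operation $\omega_A\colon A^n\to A$ for every $n$-ary symbol $\omega\in\Omega$ ($n\in\mathbb N_0$), each operation being $Q$-join-preserving in every component separately. Homomorphisms are the $Q$-join-preserving maps that commute with all the operations (constants included). Let $Q\text{-}\mathbf{Sup}\text{-}\Omega\text{-}\mathbf{Alg}$ be the resulting category. **Theorem.** The category $Q\text{-}\mathbf{Sup}\text{-}\Omega\text{-}\mathbf{Alg}$ is a monadic construct: the forgetful functor $U\colon Q\text{-}\mathbf{Sup}\text{-}\Omega\text{-}\mathbf{Alg}\to\mathbf{Set}$ has a left adjoint, and for every left adjoint $F\dashv U$, with induced monad $T$ on $\mathbf{Set}$, the comparison functor $Q\text{-}\mathbf{Sup}\text{-}\Omega\text{-}\mathbf{Alg}\to\mathbf{Set}^{T}$ to the category of Eilenberg–Moore $T$-algebras is an isomorphism of categories (commuting with the forgetful functors to $\mathbf{Set}$). -/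

import Mathlib

open CategoryTheory
open scoped Quantale

universe u

/-- A type of algebras: a set of function symbols, each with a finite arity
(nullary symbols are allowed). -/
structure AlgType where
  Symb : Type u
  arity : Symb → ℕ

section QOrder

variable {Q : Type u} [CommMonoid Q] [CompleteLattice Q] [IsQuantale Q]

/-- A `Q`-order on a set, for `Q` a unital commutative quantale. -/
structure IsQOrder {X : Type u} (e : X → X → Q) : Prop where
  refl : ∀ x, 1 ≤ e x x
  trans : ∀ x y z, e x y * e y z ≤ e x z
  antisymm : ∀ x y, 1 ≤ e x y → 1 ≤ e y x → x = y

/-- `s` is a `Q`-join of the `Q`-subset `M` of `(X, e)`.  Here `p ⇨ₗ q` is the residuum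
`sSup {r | r * p ≤ q}` of the quantale. -/
structure IsQJoin {X : Type u} (e : X → X → Q) (M : X → Q) (s : X) : Prop where
  le : ∀ x, M x ≤ e x s
  least : ∀ y, (⨅ x, (M x ⇨ₗ e x y)) ≤ e s y

/-- A `Q`-sup-lattice: a `Q`-ordered set in which every `Q`-subset has a `Q`-join. -/
structure IsQSupLattice {X : Type u} (e : X → X → Q) : Prop extends IsQOrder e where
  exists_join : ∀ M : X → Q, ∃ s, IsQJoin e M s

/-- Zadeh's forward power set operator: `f_Q^→(M)(y) = ⋁ {M x | f x = y}`. -/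
def zadeh {X Y : Type u} (f : X → Y) (M : X → Q) (y : Y) : Q :=
  ⨆ (x : X) (_ : f x = y), M x

/-- `f` preserves all existing `Q`-joins: whenever `s` is the `Q`-join of `M`, the `Q`-join of
`f_Q^→(M)` exists and is `f s`. -/
def QJoinPreserving {X Y : Type u} (eX : X → X → Q) (eY : Y → Y → Q) (f : X → Y) : Prop :=
  ∀ (M : X → Q) (s : X), IsQJoin eX M s → IsQJoin eY (zadeh f M) (f s)

end QOrder

theorem zadeh_id {Q X : Type u} [CompleteLattice Q] (M : X → Q) :
    zadeh (fun x => x) M = M := by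
  funext y
  simp [zadeh]

theorem zadeh_comp {Q X Y Z : Type u} [CompleteLattice Q] (f : X → Y) (g : Y → Z) (M : X → Q) :
    zadeh g (zadeh f M) = zadeh (fun x => g (f x)) M := by
  funext z
  apply le_antisymm
  · refine iSup₂_le fun y hy => iSup₂_le fun x hx => ?_
    exact le_iSup₂_of_le (f := fun (x : X) (_ : g (f x) = z) => M x) x
      ((congrArg g hx).trans hy) le_rfl
  · refine iSup₂_le fun x hx => ?_
    exact le_iSup₂_of_le (f x) hx (le_iSup₂_of_le x rfl le_rfl)

/-- A `Q`-sup-algebra of type `τ`: a `Q`-sup-lattice with an operation of the right arity for every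
function symbol, each operation being `Q`-join-preserving in every component. -/
structure QSupAlg (Q : Type u) [CommMonoid Q] [CompleteLattice Q] [IsQuantale Q]
    (τ : AlgType.{u}) where
  carrier : Type u
  e : carrier → carrier → Q
  isQSupLattice : IsQSupLattice e
  op : (ω : τ.Symb) → (Fin (τ.arity ω) → carrier) → carrier
  op_join : ∀ (ω : τ.Symb) (j : Fin (τ.arity ω)) (a : Fin (τ.arity ω) → carrier),
    QJoinPreserving e e (fun x => op ω (Function.update a j x))

namespace QSupAlg

variable {Q : Type u} [CommMonoid Q] [CompleteLattice Q] [IsQuantale Q] {τ : AlgType.{u}}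

/-- Homomorphisms of `Q`-sup-algebras: `Q`-join-preserving maps commuting with all operations. -/
@[ext]
structure Hom (A B : QSupAlg Q τ) where
  toFun : A.carrier → B.carrier
  join_preserving : QJoinPreserving A.e B.e toFun
  map_op : ∀ (ω : τ.Symb) (a : Fin (τ.arity ω) → A.carrier),
    toFun (A.op ω a) = B.op ω (fun i => toFun (a i))

instance (A B : QSupAlg Q τ) : FunLike (Hom A B) A.carrier B.carrier where
  coe := Hom.toFun
  coe_injective _ _ h := Hom.ext h

/-- The identity homomorphism. -/
def Hom.id (A : QSupAlg Q τ) : Hom A A where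
  toFun x := x
  join_preserving M s h := by rw [zadeh_id]; exact h
  map_op _ _ := rfl

/-- The composite of two homomorphisms. -/
def Hom.comp {A B C : QSupAlg Q τ} (f : Hom A B) (g : Hom B C) : Hom A C where
  toFun x := g.toFun (f.toFun x)
  join_preserving M s h := by
    rw [← zadeh_comp]
    exact g.join_preserving _ _ (f.join_preserving _ _ h)
  map_op ω a := by rw [f.map_op, g.map_op]

/-- The category of `Q`-sup-algebras of type `τ`. -/
instance : Category.{u} (QSupAlg.{u} Q τ) where
  Hom := Hom
  id := Hom.id
  comp := Hom.comp

/-- `Q`-sup-algebras form a construct; this provides the forgetful functor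
`forget (QSupAlg Q τ) : QSupAlg Q τ ⥤ Type u`. -/
instance : ConcreteCategory.{u} (QSupAlg.{u} Q τ) (fun A B => Hom A B) where
  hom f := f
  ofHom f := f

end QSupAlg

/-- A functor is an isomorphism of categories: it has a strict two-sided inverse. -/
def IsCategoryIso {C : Type*} [Category C] {D : Type*} [Category D] (K : C ⥤ D) : Prop :=
  ∃ G : D ⥤ C, K ⋙ G = 𝟭 C ∧ G ⋙ K = 𝟭 D

/-- A functor `U` is (strictly) monadic: it has a left adjoint, and for every left adjoint the
comparison functor to the Eilenberg–Moore category of the induced monad is an isomorphism of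
categories.  The comparison functor commutes strictly with the functors to the base, so this says
that `U` is concretely isomorphic to the forgetful functor of a category of monad algebras. -/
def IsStrictlyMonadic {C : Type*} [Category C] {D : Type*} [Category D] (U : C ⥤ D) : Prop :=
  U.IsRightAdjoint ∧ ∀ (F : D ⥤ C) (adj : F ⊣ U), IsCategoryIso (Monad.comparison adj)

/-! Joins are handled through the universal property `IsWeightedJoin` of indexed weighted families.
It absorbs `zadeh`, and join preservation becomes an exchange of universal quantifiers. The free
algebra on `X` consists of the `Q`-subsets of terms: each is the weighted join of its singletons
(`isWeightedJoin_powerSingle`), so a map on variables extends uniquely, by evaluating terms and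
taking joins. For an Eilenberg–Moore algebra `a : UFX → X`, the units split the fork of the counit
and `F a` in sets. Hence the kernel of `a` respects joins and operations (`isCongruent_of_split`),
and `X` inherits the structure by representing each point by the largest element of its fiber. The
counits are surjective homomorphisms, so algebra morphisms are homomorphisms, which gives fullness
and injectivity on objects. -/

section WeightedJoin

/-! ### Weighted joins and their preservation. -/

variable {Q : Type u} [CommMonoid Q] [CompleteLattice Q]
  {X Y : Type u} {eX : X → X → Q} {eY : Y → Y → Q}

/-- `s` is the join of the family `g` with weights `M`, expressed by its universal property. -/
def IsWeightedJoin {ι : Type*} (e : X → X → Q) (g : ι → X) (M : ι → Q) (s : X) :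
    Prop :=
  ∀ y r, r ≤ e s y ↔ ∀ i, r * M i ≤ e (g i) y

theorem IsWeightedJoin.unique (h : IsQOrder eX) {ι : Type*} {g : ι → X} {M : ι → Q} {s t : X}
    (hs : IsWeightedJoin eX g M s) (ht : IsWeightedJoin eX g M t) : s = t :=
  h.antisymm _ _ ((hs _ _).2 ((ht _ _).1 (h.refl t))) ((ht _ _).2 ((hs _ _).1 (h.refl s)))

variable [IsQuantale Q]

theorem Quantale.mul_iSup_le_iff {ι : Sort*} {r q : Q} {M : ι → Q} :
    r * (⨆ i, M i) ≤ q ↔ ∀ i, r * M i ≤ q := by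
  rw [iSup, mul_sSup_distrib, iSup_range, iSup_le_iff]

theorem forall_mul_iSup_fiber_le {ι : Type*} {g : ι → X} {M : ι → Q} {h : X → Q}
    {r : Q} :
    (∀ x, r * (⨆ (i : ι) (_ : g i = x), M i) ≤ h x) ↔ ∀ i, r * M i ≤ h (g i) := by
  simp only [Quantale.mul_iSup_le_iff]
  exact ⟨fun H i => H _ i rfl, fun H x i hi => hi ▸ H i⟩

theorem IsQOrder.isQJoin_iff (h : IsQOrder eX) {M : X → Q} {s : X} :
    IsQJoin eX M s ↔ IsWeightedJoin eX (fun x => x) M s := by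
  constructor
  · refine fun H y r => ⟨fun hr x => ?_, fun hr => le_trans (le_iInf fun x => ?_) (H.least y)⟩
    · calc r * M x ≤ eX s y * eX x s := mul_le_mul' hr (H.le x)
        _ = eX x s * eX s y := mul_comm _ _
        _ ≤ eX x y := h.trans _ _ _
    · exact Quantale.leftMulResiduation_le_iff_mul_le.2 (hr x)
  · refine fun H => ⟨fun x => ?_, fun y => (H y _).2 fun x => ?_⟩
    · simpa using (H s 1).1 (h.refl s) x
    · exact Quantale.leftMulResiduation_le_iff_mul_le.1 (iInf_le _ x)

theorem isWeightedJoin_fiber_iff {ι : Type*} {Z : Type u} {f : X → Z} {e : Z → Z → Q} {g : ι → X}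
    {M : ι → Q} {s : Z} :
    IsWeightedJoin e f (fun x => ⨆ (i : ι) (_ : g i = x), M i) s ↔
      IsWeightedJoin e (fun i => f (g i)) M s :=
  forall₂_congr fun y _ => iff_congr Iff.rfl
    (forall_mul_iSup_fiber_le (h := fun x => e (f x) y))

theorem IsQOrder.isQJoin_zadeh_iff (h : IsQOrder eY) {f : X → Y} {M : X → Q} {s : Y} :
    IsQJoin eY (zadeh f M) s ↔ IsWeightedJoin eY f M s :=
  h.isQJoin_iff.trans (isWeightedJoin_fiber_iff (f := fun x => x))

theorem qJoinPreserving_iff (hX : IsQOrder eX) (hY : IsQOrder eY) {f : X → Y} :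
    QJoinPreserving eX eY f ↔
      ∀ M s, IsWeightedJoin eX (fun x => x) M s → IsWeightedJoin eY f M (f s) := by
  simp only [QJoinPreserving, hX.isQJoin_iff, hY.isQJoin_zadeh_iff]

theorem QJoinPreserving.isWeightedJoin {f : X → Y} (hf : QJoinPreserving eX eY f)
    (hX : IsQOrder eX) (hY : IsQOrder eY) {ι : Type*} {g : ι → X} {M : ι → Q} {s : X}
    (h : IsWeightedJoin eX g M s) : IsWeightedJoin eY (fun i => f (g i)) M (f s) :=
  isWeightedJoin_fiber_iff.1 ((qJoinPreserving_iff hX hY).1 hf _ _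
    ((isWeightedJoin_fiber_iff (f := fun x => x)).2 h))

theorem IsQSupLattice.exists_isWeightedJoin (h : IsQSupLattice eX) {ι : Type*} (g : ι → X)
    (M : ι → Q) : ∃ s, IsWeightedJoin eX g M s := by
  obtain ⟨s, hs⟩ := h.exists_join fun x => ⨆ (i : ι) (_ : g i = x), M i
  exact ⟨s, (isWeightedJoin_fiber_iff (f := fun x => x)).1 (h.isQJoin_iff.1 hs)⟩

/-- Encodes the order as a join, so that anything respecting joins also controls `e`. -/
theorem IsQOrder.isWeightedJoin_pair (h : IsQOrder eX) {x y : X} {r : Q} :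
    IsWeightedJoin eX (fun b : ULift.{u} Bool => bif b.down then x else y)
      (fun b => bif b.down then r else 1) y ↔ r ≤ eX x y := by
  simp only [IsWeightedJoin, ULift.forall, Bool.forall_bool, cond_true, cond_false, mul_one]
  constructor
  · intro H
    simpa using ((H y 1).1 (h.refl y)).2
  · refine fun H z t => ⟨fun ht => ⟨ht, ?_⟩, fun ht => ht.1⟩
    calc t * r ≤ eX y z * eX x y := mul_le_mul' ht H
      _ = eX x y * eX y z := mul_comm _ _
      _ ≤ eX x z := h.trans _ _ _

theorem QJoinPreserving.le {f : X → Y} (hf : QJoinPreserving eX eY f)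
    (hX : IsQOrder eX) (hY : IsQOrder eY) (x y : X) : eX x y ≤ eY (f x) (f y) := by
  have h := hf.isWeightedJoin hX hY (hX.isWeightedJoin_pair.2 (le_refl (eX x y)))
  simp only [apply_ite f, Bool.cond_eq_ite] at h
  exact hY.isWeightedJoin_pair.1 (by simpa only [Bool.cond_eq_ite] using h)

/-- A map preserving joins in each component separately turns joins of families into the join
over all choices of indices. -/
theorem isWeightedJoin_of_separately (hX : IsQOrder eX) (hY : IsQOrder eY) {ι : Type*} :
    ∀ {n : ℕ} {φ : (Fin n → X) → Y},
      (∀ j a, QJoinPreserving eX eY fun x => φ (Function.update a j x)) →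
      ∀ {g : Fin n → ι → X} {M : Fin n → ι → Q} {s : Fin n → X},
        (∀ i, IsWeightedJoin eX (g i) (M i) (s i)) →
        IsWeightedJoin eY (fun a : Fin n → ι => φ fun i => g i (a i))
          (fun a => ∏ i, M i (a i)) (φ s)
  | 0, φ, _, g, M, s, _ => by
    intro y r
    have : ∀ t : Fin 0 → X, t = s := fun t => Subsingleton.elim _ _
    simp [this]
  | n + 1, φ, hφ, g, M, s, hs => by
    intro y r
    have h0 : QJoinPreserving eX eY fun x => φ (Fin.cons x (Fin.tail s)) := by
      have := hφ 0 s
      rw [← Fin.cons_self_tail s] at this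
      simpa only [Fin.update_cons_zero] using this
    -- The first argument is frozen; its weight `M 0 t` is later absorbed into the bound `r`.
    have ih : ∀ x, _ := fun x => isWeightedJoin_of_separately hX hY
      (φ := fun v : Fin n → X => φ (Fin.cons x v))
      (fun j a => by simpa only [Fin.cons_update] using hφ j.succ (Fin.cons x a))
      (g := fun i => g i.succ) (M := fun i => M i.succ) (s := Fin.tail s) fun i => hs i.succ
    have h := h0.isWeightedJoin hX hY (hs 0) y r
    rw [Fin.cons_self_tail] at h
    rw [h, Fin.forall_fin_succ_pi]
    refine forall_congr' fun t => (ih (g 0 t) y (r * M 0 t)).trans (forall_congr' fun v => ?_)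
    have hg : (fun i => g i ((Fin.cons t v : Fin (n + 1) → ι) i)) =
        (Fin.cons (g 0 t) fun i => g i.succ (v i) : Fin (n + 1) → X) := by
      funext i
      cases i using Fin.cases <;> rfl
    simp only [hg, Fin.prod_univ_succ, Fin.cons_zero, Fin.cons_succ, mul_assoc]

end WeightedJoin

theorem Fin.prod_update_apply {R T : Type*} [CommMonoid R] {n : ℕ} (M : Fin n → T → R)
    (j : Fin n) (K : T → R) (a : Fin n → T) :
    ∏ i, Function.update M j K i (a i) = K (a j) * ∏ i ∈ Finset.univ.erase j, M i (a i) := by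
  rw [← Finset.mul_prod_erase _ _ (Finset.mem_univ j), Function.update_self]
  congr 1
  refine Finset.prod_congr rfl fun i hi => ?_
  rw [Function.update_of_ne (Finset.ne_of_mem_erase hi)]

/-! ### The `Q`-sup-lattice of `Q`-subsets. -/

section Power

variable {Q : Type u} [CommMonoid Q] [CompleteLattice Q] [IsQuantale Q] {T : Type u}

/-- The inclusion `Q`-order on the `Q`-subsets of `T`. -/
def powerOrder (M N : T → Q) : Q :=
  ⨅ t, (M t ⇨ₗ N t)

theorem le_powerOrder_iff {M N : T → Q} {r : Q} :
    r ≤ powerOrder M N ↔ ∀ t, r * M t ≤ N t := by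
  simp only [powerOrder, le_iInf_iff, Quantale.leftMulResiduation_le_iff_mul_le]

theorem isQOrder_powerOrder : IsQOrder (powerOrder : (T → Q) → (T → Q) → Q) where
  refl M := le_powerOrder_iff.2 fun t => (one_mul _).le
  trans M N K := le_powerOrder_iff.2 fun t => by
    calc powerOrder M N * powerOrder N K * M t
        = powerOrder N K * (powerOrder M N * M t) := by rw [mul_comm (powerOrder M N), mul_assoc]
      _ ≤ powerOrder N K * N t := mul_le_mul_right (le_powerOrder_iff.1 le_rfl t) _
      _ ≤ K t := le_powerOrder_iff.1 le_rfl t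
  antisymm M N h h' := funext fun t => le_antisymm
    (by simpa using le_powerOrder_iff.1 h t) (by simpa using le_powerOrder_iff.1 h' t)

theorem isWeightedJoin_powerOrder {ι : Type*} (g : ι → T → Q) (M : ι → Q) :
    IsWeightedJoin powerOrder g M fun t => ⨆ i, M i * g i t := by
  intro N r
  simp only [le_powerOrder_iff, Quantale.mul_iSup_le_iff, mul_assoc]
  exact forall_comm

theorem isQSupLattice_powerOrder : IsQSupLattice (powerOrder : (T → Q) → (T → Q) → Q) where
  toIsQOrder := isQOrder_powerOrder
  exists_join M := ⟨_, isQOrder_powerOrder.isQJoin_iff.2 (isWeightedJoin_powerOrder _ M)⟩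

/-- The characteristic `Q`-subset of an element. -/
def powerSingle (t t' : T) : Q :=
  ⨆ _ : t = t', 1

/-- The Yoneda lemma for `Q`-subsets. -/
theorem le_powerOrder_powerSingle_iff {t : T} {N : T → Q} {r : Q} :
    r ≤ powerOrder (powerSingle t) N ↔ r ≤ N t := by
  simp only [le_powerOrder_iff, powerSingle, Quantale.mul_iSup_le_iff, mul_one]
  exact ⟨fun H => H t rfl, fun H t' ht => ht ▸ H⟩

theorem isWeightedJoin_powerSingle (M : T → Q) :
    IsWeightedJoin powerOrder (fun t => powerSingle t) M M := by
  intro N r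
  exact le_powerOrder_iff.trans (forall_congr' fun t => le_powerOrder_powerSingle_iff.symm)

end Power

/-- Terms of type `τ` in the variables `X`. -/
inductive AlgType.Term (τ : AlgType.{u}) (X : Type u) : Type u
  | var (x : X) : τ.Term X
  | node (ω : τ.Symb) (a : Fin (τ.arity ω) → τ.Term X) : τ.Term X

/-! ### Terms and the free algebra. -/

namespace AlgType.Term

variable {Q : Type u} [CommMonoid Q] [CompleteLattice Q] [IsQuantale Q]
  {τ : AlgType.{u}} {X : Type u}

/-- The operations on `Q`-sets of terms: the separately join-preserving extensions of the
term constructors. -/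
def powerOp (ω : τ.Symb) (M : Fin (τ.arity ω) → τ.Term X → Q) (t : τ.Term X) : Q :=
  ⨆ (a : Fin (τ.arity ω) → τ.Term X) (_ : node ω a = t), ∏ i, M i (a i)

theorem le_powerOrder_powerOp_iff {ω : τ.Symb} {M : Fin (τ.arity ω) → τ.Term X → Q}
    {N : τ.Term X → Q} {r : Q} :
    r ≤ powerOrder (powerOp ω M) N ↔ ∀ a, r * ∏ i, M i (a i) ≤ N (node ω a) :=
  le_powerOrder_iff.trans (forall_mul_iSup_fiber_le (h := N))

theorem qJoinPreserving_powerOp (ω : τ.Symb) (j : Fin (τ.arity ω))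
    (M : Fin (τ.arity ω) → τ.Term X → Q) :
    QJoinPreserving powerOrder powerOrder fun K => powerOp ω (Function.update M j K) := by
  refine (qJoinPreserving_iff isQOrder_powerOrder isQOrder_powerOrder).2 fun W s hs N r => ?_
  obtain rfl := hs.unique isQOrder_powerOrder (isWeightedJoin_powerOrder _ W)
  simp only [le_powerOrder_powerOp_iff, Fin.prod_update_apply, Quantale.iSup_mul_distrib,
    Quantale.mul_iSup_le_iff, mul_assoc]
  exact forall_comm

theorem powerOp_powerSingle (ω : τ.Symb) (a : Fin (τ.arity ω) → τ.Term X) :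
    powerOp ω (fun i => powerSingle (a i)) = (powerSingle (node ω a) : τ.Term X → Q) := by
  funext t
  refine le_antisymm (iSup₂_le fun b hb => ?_) (iSup_le fun h => le_iSup₂_of_le a h ?_)
  · by_cases hab : a = b
    · subst hab
      simp [powerSingle, hb]
    -- A coordinate where `a` and `b` differ contributes the factor `⊥`, which annihilates the
    -- product.
    · obtain ⟨i, hi⟩ := Function.ne_iff.1 hab
      rw [← Finset.mul_prod_erase _ _ (Finset.mem_univ i)]
      simp [powerSingle, hi]
  · simp [powerSingle]

/-- Evaluation of terms in a `Q`-sup-algebra. -/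
def eval (A : QSupAlg Q τ) (f : X → A.carrier) : τ.Term X → A.carrier
  | var x => f x
  | node ω a => A.op ω fun i => (a i).eval A f

end AlgType.Term

namespace QSupAlg

variable {Q : Type u} [CommMonoid Q] [CompleteLattice Q] [IsQuantale Q] {τ : AlgType.{u}}

theorem isQOrder (A : QSupAlg Q τ) : IsQOrder A.e :=
  A.isQSupLattice.toIsQOrder

theorem Hom.isWeightedJoin {A B : QSupAlg Q τ} (f : Hom A B) {ι : Type*} {g : ι → A.carrier}
    {M : ι → Q} {s : A.carrier} (h : IsWeightedJoin A.e g M s) :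
    IsWeightedJoin B.e (fun i => f.toFun (g i)) M (f.toFun s) :=
  f.join_preserving.isWeightedJoin A.isQOrder B.isQOrder h

/-- The join of a weighted family in a `Q`-sup-algebra. -/
noncomputable def weightedJoin (A : QSupAlg Q τ) {ι : Type*} (g : ι → A.carrier) (M : ι → Q) :
    A.carrier :=
  (A.isQSupLattice.exists_isWeightedJoin g M).choose

theorem isWeightedJoin_weightedJoin (A : QSupAlg Q τ) {ι : Type*} (g : ι → A.carrier)
    (M : ι → Q) : IsWeightedJoin A.e g M (A.weightedJoin g M) :=
  (A.isQSupLattice.exists_isWeightedJoin g M).choose_spec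

/-- The free `Q`-sup-algebra on a set: the `Q`-sets of terms. -/
def free (Q : Type u) [CommMonoid Q] [CompleteLattice Q] [IsQuantale Q] (τ : AlgType.{u})
    (X : Type u) : QSupAlg Q τ where
  carrier := τ.Term X → Q
  e := powerOrder
  isQSupLattice := isQSupLattice_powerOrder
  op := AlgType.Term.powerOp
  op_join := AlgType.Term.qJoinPreserving_powerOp

variable {X : Type u}

/-- The inclusion of generators into the free `Q`-sup-algebra. -/
def freeVar (X : Type u) (x : X) : (free Q τ X).carrier :=
  powerSingle (AlgType.Term.var x : τ.Term X)

/-- The extension of a map to a homomorphism on the free `Q`-sup-algebra. -/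
noncomputable def freeLift (A : QSupAlg Q τ) (f : X → A.carrier) : Hom (free Q τ X) A where
  toFun M := A.weightedJoin (AlgType.Term.eval A f) M
  join_preserving := by
    refine (qJoinPreserving_iff isQOrder_powerOrder A.isQOrder).2 fun W s hs y r => ?_
    obtain rfl := hs.unique isQOrder_powerOrder (isWeightedJoin_powerOrder _ W)
    rw [A.isWeightedJoin_weightedJoin _ _ y r]
    simp only [A.isWeightedJoin_weightedJoin _ _ y _, Quantale.mul_iSup_le_iff, mul_assoc]
    exact forall_comm
  map_op ω M := by
    have h := isWeightedJoin_of_separately A.isQOrder A.isQOrder (A.op_join ω)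
      fun i => A.isWeightedJoin_weightedJoin (AlgType.Term.eval A f) (M i)
    refine IsWeightedJoin.unique A.isQOrder (fun y r => ?_) h
    refine (A.isWeightedJoin_weightedJoin _ _ y r).trans ?_
    -- `powerOp` pushes the product weights forward along `node ω`, so both joins have the same
    -- upper bounds.
    exact forall_mul_iSup_fiber_le (h := fun t => A.e (AlgType.Term.eval A f t) y)

theorem freeLift_freeVar (A : QSupAlg Q τ) (f : X → A.carrier) (x : X) :
    (freeLift A f).toFun (freeVar X x) = f x := by
  refine (A.isWeightedJoin_weightedJoin _ _).unique A.isQOrder (fun y r => ?_)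
  exact (le_powerOrder_powerSingle_iff (t := .var x)
    (N := fun t => A.e (AlgType.Term.eval A f t) y)).symm.trans le_powerOrder_iff

/-- Singletons of terms are generated from variables by the operations, and they generate everything
under joins. -/
theorem Hom.free_ext {A : QSupAlg Q τ} {f g : Hom (free Q τ X) A}
    (h : ∀ x, f.toFun (freeVar X x) = g.toFun (freeVar X x)) : f = g := by
  have key : ∀ t : τ.Term X, f.toFun (powerSingle t) = g.toFun (powerSingle t) := by
    intro t
    induction t with
    | var x => exact h x
    | node ω a ih =>
      rw [← AlgType.Term.powerOp_powerSingle]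
      refine (f.map_op ω _).trans (Eq.trans ?_ (g.map_op ω _).symm)
      exact congrArg (A.op ω) (funext ih)
  refine Hom.ext (funext fun M => ?_)
  have hf := f.isWeightedJoin (isWeightedJoin_powerSingle M)
  have hg := g.isWeightedJoin (isWeightedJoin_powerSingle M)
  simp only [key] at hf
  exact hf.unique A.isQOrder hg

end QSupAlg

/-! ### Quotients by congruent maps. -/

namespace QSupAlg

variable {Q : Type u} [CommMonoid Q] [CompleteLattice Q] [IsQuantale Q] {τ : AlgType.{u}}

/-- A map out of a `Q`-sup-algebra whose kernel is compatible with joins and operations. -/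
structure IsCongruent (B : QSupAlg Q τ) {Z : Type u} (q : B.carrier → Z) : Prop where
  join : ∀ {ι : Type u} {g g' : ι → B.carrier} {M : ι → Q} {s s' : B.carrier},
    IsWeightedJoin B.e g M s → IsWeightedJoin B.e g' M s' → (∀ i, q (g i) = q (g' i)) → q s = q s'
  op : ∀ (ω : τ.Symb) {b b' : Fin (τ.arity ω) → B.carrier}, (∀ i, q (b i) = q (b' i)) →
    q (B.op ω b) = q (B.op ω b')

variable {B : QSupAlg Q τ} {Z : Type u} {q : B.carrier → Z}

/-- The largest element of a fiber of a congruent map. -/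
noncomputable def fiberTop (B : QSupAlg Q τ) (q : B.carrier → Z) (z : Z) : B.carrier :=
  B.weightedJoin (fun b : {b // q b = z} => b.1) fun _ => 1

theorem le_fiberTop (b : B.carrier) : 1 ≤ B.e b (B.fiberTop q (q b)) := by
  simpa [fiberTop] using (B.isWeightedJoin_weightedJoin (fun b' : {b' // q b' = q b} => b'.1)
    (fun _ => 1) _ 1).1 (B.isQOrder.refl _) ⟨b, rfl⟩

namespace IsCongruent

theorem map_fiberTop (hq : B.IsCongruent q) (hs : Function.Surjective q) (z : Z) :
    q (B.fiberTop q z) = z := by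
  obtain ⟨b, hb⟩ := hs z
  rw [← hb]
  -- Compare the fiber with the constant family `b` over the same index set; as the fiber is
  -- nonempty, the latter has join `b`.
  refine hq.join (B.isWeightedJoin_weightedJoin _ _)
    (g' := fun _ : {b' // q b' = q b} => b) (fun y r => ?_) fun i => i.2
  exact ⟨fun h _ => by simpa using h, fun h => by simpa using h ⟨b, rfl⟩⟩

/-- This makes `q` left adjoint to `fiberTop`, hence join-preserving. Joining `fiberTop q w` with
either `b` or `fiberTop q (q b)`, at weight `r`, gives the same image under `q`; for `b` the join is
`fiberTop q w` itself, so the other join lies in the fiber of `w`, below its top. -/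
theorem le_fiberTop_iff (hq : B.IsCongruent q) (hs : Function.Surjective q) {b : B.carrier} {w : Z}
    {r : Q} : r ≤ B.e (B.fiberTop q (q b)) (B.fiberTop q w) ↔ r ≤ B.e b (B.fiberTop q w) := by
  constructor
  · intro h
    calc r = 1 * r := (one_mul r).symm
      _ ≤ _ := mul_le_mul' (le_fiberTop b) h
      _ ≤ _ := B.isQOrder.trans _ _ _
  · intro h
    have hJ := B.isWeightedJoin_weightedJoin
      (fun i : ULift.{u} Bool => bif i.down then B.fiberTop q (q b) else B.fiberTop q w)
      (fun i => bif i.down then r else 1)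
    have hw := hq.join hJ (B.isQOrder.isWeightedJoin_pair.2 h) (by
      rintro ⟨_ | _⟩
      · rfl
      · exact hq.map_fiberTop hs _)
    rw [hq.map_fiberTop hs] at hw
    have h1 := (hJ _ 1).1 (le_fiberTop (q := q) _) ⟨true⟩
    rw [hw] at h1
    simpa using h1

/-- The quotient of a `Q`-sup-algebra by a congruent map, as a structure on the codomain. -/
noncomputable def quotient (hq : B.IsCongruent q) (hs : Function.Surjective q) : QSupAlg Q τ :=
  have hm : Function.LeftInverse q (B.fiberTop q) := hq.map_fiberTop hs
  have ho : IsQOrder fun z w => B.e (B.fiberTop q z) (B.fiberTop q w) :=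
    { refl := fun _ => B.isQOrder.refl _
      trans := fun _ _ _ => B.isQOrder.trans _ _ _
      antisymm := fun _ _ h h' => hm.injective (B.isQOrder.antisymm _ _ h h') }
  have hJ : ∀ {ι : Type u} {g : ι → B.carrier} {M : ι → Q} {s : B.carrier},
      IsWeightedJoin B.e g M s →
      IsWeightedJoin (fun z w => B.e (B.fiberTop q z) (B.fiberTop q w)) (fun i => q (g i)) M
        (q s) := fun h w r => by
    simp only [hq.le_fiberTop_iff hs]
    exact h _ r
  { carrier := Z
    e := fun z w => B.e (B.fiberTop q z) (B.fiberTop q w)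
    isQSupLattice :=
      { toIsQOrder := ho
        exists_join := fun M => by
          refine ⟨q (B.weightedJoin (B.fiberTop q) M), ho.isQJoin_iff.2 ?_⟩
          have h := hJ (B.isWeightedJoin_weightedJoin (B.fiberTop q) M)
          simp only [hq.map_fiberTop hs] at h
          exact h }
    op := fun ω a => q (B.op ω fun i => B.fiberTop q (a i))
    op_join := fun ω j a => by
      refine (qJoinPreserving_iff ho ho).2 fun M s h => ?_
      have hB := B.isWeightedJoin_weightedJoin (B.fiberTop q) M
      have hZ := hJ hB
      simp only [hq.map_fiberTop hs] at hZ
      -- Every join in `Z` is thus the image of a join of fiber tops.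
      obtain rfl := hZ.unique ho h
      have hop := hJ ((B.op_join ω j fun i => B.fiberTop q (a i)).isWeightedJoin
        B.isQOrder B.isQOrder hB)
      have hu : ∀ x, (fun i => B.fiberTop q (Function.update a j x i)) =
          Function.update (fun i => B.fiberTop q (a i)) j (B.fiberTop q x) := fun x =>
        Function.comp_update (B.fiberTop q) a j x
      simp only [hu]
      convert hop using 1
      refine hq.op ω fun i => ?_
      rcases eq_or_ne i j with rfl | hi
      · simp [hq.map_fiberTop hs]
      · simp [hi] }

/-- The quotient map. -/
noncomputable def proj (hq : B.IsCongruent q) (hs : Function.Surjective q) :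
    Hom B (hq.quotient hs) where
  toFun := q
  join_preserving := (qJoinPreserving_iff B.isQOrder (hq.quotient hs).isQOrder).2
    fun _ _ h _ r => (hq.le_fiberTop_iff hs).trans ((h _ r).trans
      (forall_congr' fun _ => (hq.le_fiberTop_iff hs).symm))
  map_op ω _ := hq.op ω fun _ => (hq.map_fiberTop hs _).symm

end IsCongruent

/-- The kernel pair condition under which a map out of a `Q`-sup-algebra is congruent: it
coequalizes two homomorphisms, split by maps of sets. -/
theorem isCongruent_of_split {A : QSupAlg Q τ} (f g : Hom A B) (s : Z → B.carrier)
    (t : B.carrier → A.carrier) (hfg : ∀ a, q (f.toFun a) = q (g.toFun a))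
    (hf : ∀ b, f.toFun (t b) = b) (hg : ∀ b, g.toFun (t b) = s (q b)) : B.IsCongruent q := by
  have hJ : ∀ {ι : Type u} {b : ι → B.carrier} {M : ι → Q} {x : B.carrier},
      IsWeightedJoin B.e b M x → q x = q (B.weightedJoin (fun i => s (q (b i))) M) := by
    intro ι b M x h
    -- Lift the family along `t`: `f` returns it, `g` replaces each `b i` by `s (q (b i))`, and `q`
    -- cannot tell the results apart.
    have hA := A.isWeightedJoin_weightedJoin (fun i => t (b i)) M
    have h1 := f.isWeightedJoin hA
    have h2 := g.isWeightedJoin hA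
    simp only [hf] at h1
    simp only [hg] at h2
    rw [h.unique B.isQOrder h1, hfg, h2.unique B.isQOrder (B.isWeightedJoin_weightedJoin _ _)]
  have hO : ∀ (ω : τ.Symb) (b : Fin (τ.arity ω) → B.carrier),
      q (B.op ω b) = q (B.op ω fun i => s (q (b i))) := by
    intro ω b
    have h := hfg (A.op ω fun i => t (b i))
    simpa only [f.map_op, g.map_op, hf, hg] using h
  refine ⟨fun h h' hi => ?_, fun ω b b' hi => ?_⟩
  · rw [hJ h, hJ h']
    simp only [hi]
  · rw [hO ω b, hO ω b']
    simp only [hi]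

/-- A map is a homomorphism if its composite with a surjective homomorphism is one. -/
def Hom.desc {A B C : QSupAlg Q τ} (p : Hom A B) (hp : Function.Surjective p.toFun)
    (f : B.carrier → C.carrier) (h : Hom A C) (hf : ∀ a, f (p.toFun a) = h.toFun a) :
    Hom B C where
  toFun := f
  join_preserving := by
    refine (qJoinPreserving_iff B.isQOrder C.isQOrder).2 fun M s hs => ?_
    obtain ⟨σ, hσ⟩ := hp.hasRightInverse
    have hA := A.isWeightedJoin_weightedJoin σ M
    have hB := p.isWeightedJoin hA
    have hC := h.isWeightedJoin hA
    simp only [hσ _] at hB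
    simp only [← hf, hσ _, hB.unique B.isQOrder hs] at hC
    exact hC
  map_op ω a := by
    obtain ⟨σ, hσ⟩ := hp.hasRightInverse
    have h1 := p.map_op ω fun i => σ (a i)
    have h2 := h.map_op ω fun i => σ (a i)
    simp only [hσ _] at h1
    simp only [← hf, h1, hσ _] at h2
    exact h2

/-- Two `Q`-sup-algebra structures on the same set agree if the identity is a homomorphism in both
directions. -/
theorem eq_of_hom {A B : QSupAlg Q τ} (hc : A.carrier = B.carrier) (f : Hom A B) (g : Hom B A)
    (hf : ∀ x, f.toFun x = cast hc x) (hg : ∀ x, g.toFun x = cast hc.symm x) : A = B := by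
  have hfe := f.join_preserving.le A.isQOrder B.isQOrder
  have hge := g.join_preserving.le B.isQOrder A.isQOrder
  have hop := f.map_op
  obtain ⟨X, e, _, op, _⟩ := A
  obtain ⟨Y, e', _, op', _⟩ := B
  obtain rfl : X = Y := hc
  simp only [hf, hg, cast_eq] at hfe hge hop
  obtain rfl : e = e' := funext₂ fun x y => le_antisymm (hfe x y) (hge x y)
  obtain rfl : op = op' := funext₂ hop
  rfl

end QSupAlg

/-! ### Adjunction and comparison functor. -/

namespace QSupAlg

variable {Q : Type u} [CommMonoid Q] [CompleteLattice Q] [IsQuantale Q] {τ : AlgType.{u}}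

/-- Homomorphisms out of the free `Q`-sup-algebra correspond to maps on the generators. -/
noncomputable def freeHomEquiv (X : Type u) (A : QSupAlg.{u} Q τ) :
    (free Q τ X ⟶ A) ≃ (X ⟶ (forget (QSupAlg.{u} Q τ)).obj A) where
  toFun f := TypeCat.ofHom fun x => Hom.toFun f (freeVar X x)
  invFun f := freeLift A fun x => f x
  left_inv f := Hom.free_ext fun x => freeLift_freeVar A _ x
  right_inv f := by
    ext x
    exact freeLift_freeVar A _ x

theorem forget_isRightAdjoint : (forget (QSupAlg.{u} Q τ)).IsRightAdjoint :=
  (Adjunction.adjunctionOfEquivLeft freeHomEquiv fun _ _ _ _ _ => rfl).isRightAdjoint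

variable {F : Type u ⥤ QSupAlg.{u} Q τ} (adj : F ⊣ forget (QSupAlg.{u} Q τ))

theorem isCongruent_algebra (X : adj.toMonad.Algebra) :
    (F.obj X.A).IsCongruent (Z := X.A) fun x => X.a x := by
  refine isCongruent_of_split (A := F.obj ((forget (QSupAlg.{u} Q τ)).obj (F.obj X.A)))
    (adj.counit.app (F.obj X.A)) (F.map X.a) (fun x => adj.unit.app X.A x)
    (fun b => adj.unit.app _ b) (fun a => ?_) (fun b => ?_) (fun b => ?_)
  · exact ConcreteCategory.congr_hom X.assoc a
  · exact ConcreteCategory.congr_hom (adj.right_triangle_components (F.obj X.A)) b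
  · exact (ConcreteCategory.congr_hom (adj.unit.naturality X.a) b).symm

theorem algebra_a_surjective (X : adj.toMonad.Algebra) : Function.Surjective fun x => X.a x :=
  fun z => ⟨adj.unit.app X.A z, ConcreteCategory.congr_hom X.unit z⟩

/-- The `Q`-sup-algebra structure on the carrier of an Eilenberg-Moore algebra. -/
noncomputable def ofAlgebra (X : adj.toMonad.Algebra) : QSupAlg.{u} Q τ :=
  (isCongruent_algebra adj X).quotient (algebra_a_surjective adj X)

/-- The structure map of an Eilenberg-Moore algebra as a homomorphism. -/
noncomputable def ofAlgebraProj (X : adj.toMonad.Algebra) : F.obj X.A ⟶ ofAlgebra adj X :=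
  (isCongruent_algebra adj X).proj (algebra_a_surjective adj X)

/-- Both sides are adjoint to the identity of `X.A`: by a triangle identity and by the unit law of
`X`. -/
theorem counit_ofAlgebra (X : adj.toMonad.Algebra) :
    adj.counit.app (ofAlgebra adj X) = ofAlgebraProj adj X := by
  apply (adj.homEquiv _ _).injective
  refine ((adj.homEquiv_unit _ _ _).trans (adj.right_triangle_components _)).trans ?_
  exact X.unit.symm.trans (adj.homEquiv_unit X.A _ (ofAlgebraProj adj X)).symm

theorem comparison_ofAlgebra (X : adj.toMonad.Algebra) :
    (Monad.comparison adj).obj (ofAlgebra adj X) = X := by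
  obtain ⟨A, a, h, h'⟩ := X
  simp only [Monad.comparison]
  congr
  exact congrArg Hom.toFun (counit_ofAlgebra adj ⟨A, a, h, h'⟩)

/-- A morphism between the algebras underlying two `Q`-sup-algebras is a homomorphism. -/
def homOfAlgebraHom {A B : QSupAlg.{u} Q τ}
    (f : (Monad.comparison adj).obj A ⟶ (Monad.comparison adj).obj B) : A ⟶ B :=
  Hom.desc (adj.counit.app A)
    (fun z => ⟨adj.unit.app _ z, ConcreteCategory.congr_hom (adj.right_triangle_components A) z⟩)
    (fun x => f.f x) (F.map f.f ≫ adj.counit.app B)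
    fun x => (ConcreteCategory.congr_hom f.h x).symm

theorem comparison_map_homOfAlgebraHom {A B : QSupAlg.{u} Q τ}
    (f : (Monad.comparison adj).obj A ⟶ (Monad.comparison adj).obj B) :
    (Monad.comparison adj).map (homOfAlgebraHom adj f) = f :=
  rfl

theorem comparison_obj_injective : Function.Injective (Monad.comparison adj).obj := by
  intro A B h
  have hc : A.carrier = B.carrier := congrArg Monad.Algebra.A h
  -- Equal algebras have the identity, up to `cast`, as an algebra morphism in both directions.
  have key : ∀ {X Y : adj.toMonad.Algebra} (h : X = Y) (x : X.A),
      (eqToHom h).f x = cast (congrArg Monad.Algebra.A h) x := by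
    rintro X _ rfl x
    rfl
  exact eq_of_hom hc (homOfAlgebraHom adj (eqToHom h)) (homOfAlgebraHom adj (eqToHom h.symm))
    (fun x => key h x) fun x => key h.symm x

end QSupAlg

/-- A fully faithful functor that is bijective on objects is an isomorphism of categories. -/
theorem isCategoryIso_of_bijective {C : Type*} [Category C] {D : Type*} [Category D] (K : C ⥤ D)
    [K.Full] [K.Faithful] (hK : Function.Bijective K.obj) : IsCategoryIso K := by
  obtain ⟨σ, hl, hr⟩ := Function.bijective_iff_has_inverse.1 hK
  let G : D ⥤ C :=
    { obj := σ
      map := fun {X Y} f => K.preimage (eqToHom (hr X) ≫ f ≫ eqToHom (hr Y).symm)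
      map_id := fun X => K.map_injective (by simp)
      map_comp := fun f g => K.map_injective (by simp) }
  refine ⟨G, CategoryTheory.Functor.ext hl fun A B f => K.map_injective ?_,
    CategoryTheory.Functor.ext hr fun X Y f => ?_⟩
  · simp [G, eqToHom_map]
  · simp [G]

theorem mainTheorem5 (Q : Type u) [CommMonoid Q] [CompleteLattice Q] [IsQuantale Q]
    (τ : AlgType.{u}) :
    IsStrictlyMonadic (forget (QSupAlg.{u} Q τ)) := by
  refine ⟨QSupAlg.forget_isRightAdjoint, fun F adj => ?_⟩
  have : (Monad.comparison adj).Full :=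
    ⟨fun f => ⟨QSupAlg.homOfAlgebraHom adj f, QSupAlg.comparison_map_homOfAlgebraHom adj f⟩⟩
  exact isCategoryIso_of_bijective _ ⟨QSupAlg.comparison_obj_injective adj,
    fun X => ⟨_, QSupAlg.comparison_ofAlgebra adj X⟩⟩
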